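/- Let $d\in\{2,3\}$ and let $\kappa\subset\mathbb R^d$ be a nonempty bounded open polygonal ($d=2$) or polyhedral ($d=3$) element, i.e. $\partial\kappa$ is the union of finitely many closed $(d-1)$-dimensional simplices $F$ (the faces of $\kappa$) with pairwise disjoint relative interiors. Let $h_\kappa=\operatorname{diam}\kappa$ and let $C_s>0$ be a constant. Suppose that there are non-degenerate $d$-dimensional simplices $\kappa_\flat^F$, one for each face $F$, with pairwise disjoint interiors, such that each $\kappa_\flat^F$ has $F$ as one of its facets, the interior of $\kappa_\flat^F$ is contained in $\kappa$, and $$h_\kappa\le C_s\,\frac{d\,|\kappa_\flat^F|}{|F|}\qquad\text{for every face }F,$$ where $|\kappa_\flat^F|$ is the $d$-dimensional and $|F|$ the $(d-1)$-dimensional (Euclidean) measure. Then, for every integer $p\ge 0$ and every $v\in\mathcal H_p(\kappa)$, that is, every polynomial $v$ of total degree at most $p$ with $\Delta v=0$ on $\kappa$, $$\|\nabla v\|_{L_2(\kappa)}^2\le\Big(C_s\,\frac{(p+1)(p+d)}{h_\kappa}\Big)^2\,\|v\|_{L_2(\kappa)}^2 .$$ In particular, apart from $C_s$, the constant depends neither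 on the number nor on the size of the faces. -/

import Mathlib

open MeasureTheory

noncomputable section

/-- A bounded open polytopic element of `ℝ^d` (polygonal for `d = 2`, polyhedral for `d = 3`),
together with a finite subdivision of its boundary into `(d-1)`-dimensional simplices, the faces,
with pairwise disjoint relative interiors. No bound on the number of faces, no convexity and no
shape regularity is imposed. -/
structure PolytopicElement (d : ℕ) where
  /-- the open point set -/
  carrier : Set (EuclideanSpace ℝ (Fin d))
  /-- the `(d-1)`-dimensional simplicial faces -/
  faces : Set (Affine.Simplex ℝ (EuclideanSpace ℝ (Fin d)) (d - 1))
  isOpen : IsOpen carrier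
  isBounded : Bornology.IsBounded carrier
  nonempty : carrier.Nonempty
  finite_faces : faces.Finite
  disjoint_faces : faces.Pairwise fun F G => Disjoint F.interior G.interior
  frontier_eq : frontier carrier = ⋃ F ∈ faces, F.closedInterior

namespace PolytopicElement

variable {d : ℕ}

/-- The diameter `h_κ`. -/
def h (κ : PolytopicElement d) : ℝ := Metric.diam κ.carrier

/-- The `d`-dimensional simplices that are contained (as open simplices) in the open element `κ`
and have `F` as one of their faces: the facet of `T` opposite to some vertex `i` has the same
vertices as `F`. -/
def simplicesOn (κ : PolytopicElement d)
    (F : Affine.Simplex ℝ (EuclideanSpace ℝ (Fin d)) (d - 1)) :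
    Set (Affine.Simplex ℝ (EuclideanSpace ℝ (Fin d)) d) :=
  {T | T.interior ⊆ κ.carrier ∧ ∃ i, T.points '' {i}ᶜ = Set.range F.points}

/-- The mesh regularity condition for elements with an arbitrary number of faces: there are
pairwise non-overlapping simplices `T F ⊆ κ`, one for each face `F` of `κ` and having `F` as a
face, such that `h_κ ≤ C_s * (d |T F| / |F|)`. Here `|T F|` is the `d`-dimensional Lebesgue
measure and `|F|` is the `(d-1)`-dimensional surface (normalized Hausdorff) measure. -/
def ArbitraryFaces (κ : PolytopicElement d) (Cs : ℝ) : Prop :=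
  ∃ T : κ.faces → Affine.Simplex ℝ (EuclideanSpace ℝ (Fin d)) d,
    (∀ F : κ.faces, T F ∈ κ.simplicesOn F) ∧
    (Pairwise fun F G : κ.faces => Disjoint (T F).interior (T G).interior) ∧
    ∀ F : κ.faces,
      κ.h ≤ Cs * ((d : ℝ) * volume.real (T F).closedInterior /
        (μHE[d - 1] : Measure (EuclideanSpace ℝ (Fin d))).real F.1.closedInterior)

/-- `P_p(κ)`: functions that agree on `κ` with a polynomial of total degree at most `p` in the
physical coordinates. -/
def polynomialSpace (κ : PolytopicElement d) (p : ℕ) : Set (EuclideanSpace ℝ (Fin d) → ℝ) :=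
  {v | ∃ P : MvPolynomial (Fin d) ℝ, P.totalDegree ≤ p ∧
    ∀ x ∈ κ.carrier, v x = MvPolynomial.eval (fun i => x i) P}

/-- `H_p(κ)`: the members of `P_p(κ)` whose Laplacian vanishes on `κ`. -/
def harmonicPolynomialSpace (κ : PolytopicElement d) (p : ℕ) :
    Set (EuclideanSpace ℝ (Fin d) → ℝ) :=
  {v | v ∈ κ.polynomialSpace p ∧ ∀ x ∈ κ.carrier, Laplacian.laplacian v x = 0}

end PolytopicElement

end

/-! Write `d = m + 1`. Since `Δv = 0`, `|∇v|²` is the divergence of `v ∇v` on the element, so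
`‖∇v‖²` is controlled by surface integrals of the products `v ∂ⱼv`. For any `M > 0`, Young's
inequality gives `|nⱼ| |v ∂ⱼv| ≤ (M/2) nⱼ² v² + (∂ⱼv)²/(2M)`. Summing over `j` with `|n| = 1` leaves
`(M/2) v² + |∇v|²/(2M)` on every face.

The traces return to the interior by the inequality `∑_F ∫_F q² ≤ M ∫_κ q²`, valid for all
polynomials `q` of degree at most `p` with `M = C_s (p+1)(p+d)/h_κ`. Applied to `v` and to each
`∂ⱼv`, it yields `‖∇v‖² ≤ (M²/2) ‖v‖² + ‖∇v‖²/2`, and absorbing the last term gives the constant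
`M²` (`harmonic_inverse_estimate`).

The trace inequality is local. On the simplex over `F`, integration along rays from the apex
(`setLIntegral_coneOver`) reduces it to the bound `f(1)² ≤ (p+1)(p+d) ∫₀¹ r^(d-1) f(r)² dr`
(`jacobiForm.sq_eval_one_le`). The height of the simplex is `d|T|/|F| ≥ h_κ/C_s`. As the simplices
do not overlap, summing over faces costs nothing, whatever their number.

The divergence theorem is needed only as an upper bound with `|nⱼ|` (`enorm_setIntegral_fderiv_le`).
It comes from translating the domain: a set and its translate differ only where some face has swept.
Neither outward normals nor boundary regularity enter. -/

/-! ### Endpoint evaluation of polynomials with weight `r ^ m` on `[0, 1]` -/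

open Polynomial in
/-- The bilinear form `(f, g) ↦ ∫₀¹ r ^ m f(r) g(r) dr` on real polynomials. -/
noncomputable def jacobiForm (m : ℕ) : ℝ[X] →ₗ[ℝ] ℝ[X] →ₗ[ℝ] ℝ :=
  LinearMap.mk₂ ℝ (fun f g => ∫ r in (0 : ℝ)..1, r ^ m * (f.eval r * g.eval r))
    (fun f₁ f₂ g => by
      rw [← intervalIntegral.integral_add (Continuous.intervalIntegrable (by fun_prop) _ _)
        (Continuous.intervalIntegrable (by fun_prop) _ _)]
      congr 1; ext r; simp only [eval_add]; ring)
    (fun c f g => by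
      rw [smul_eq_mul, ← intervalIntegral.integral_const_mul]
      congr 1; ext r; simp only [eval_smul, smul_eq_mul]; ring)
    (fun f g₁ g₂ => by
      rw [← intervalIntegral.integral_add (Continuous.intervalIntegrable (by fun_prop) _ _)
        (Continuous.intervalIntegrable (by fun_prop) _ _)]
      congr 1; ext r; simp only [eval_add]; ring)
    (fun c f g => by
      rw [smul_eq_mul, ← intervalIntegral.integral_const_mul]
      congr 1; ext r; simp only [eval_smul, smul_eq_mul]; ring)

namespace jacobiForm

open Polynomial

variable (m : ℕ)

theorem apply (f g : ℝ[X]) :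
    jacobiForm m f g = ∫ r in (0 : ℝ)..1, r ^ m * (f.eval r * g.eval r) := rfl

theorem self_nonneg (f : ℝ[X]) : 0 ≤ jacobiForm m f f := by
  rw [apply]
  refine intervalIntegral.integral_nonneg zero_le_one fun r hr => ?_
  exact mul_nonneg (pow_nonneg hr.1 _) (mul_self_nonneg _)

theorem self_pos {f : ℝ[X]} (hf : f ≠ 0) : 0 < jacobiForm m f f := by
  rw [apply]
  obtain ⟨c, hc, hcf⟩ : ∃ c ∈ Set.Ioo (0 : ℝ) 1, f.eval c ≠ 0 := by
    by_contra! h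
    exact hf (eq_zero_of_infinite_isRoot f ((Set.Ioo_infinite zero_lt_one).mono fun c hc => h c hc))
  refine intervalIntegral.integral_pos zero_lt_one (by fun_prop)
    (fun r hr => mul_nonneg (pow_nonneg hr.1.le _) (mul_self_nonneg _))
    ⟨c, ⟨hc.1.le, hc.2.le⟩, ?_⟩
  exact mul_pos (pow_pos hc.1 _) (mul_self_pos.2 hcf)

theorem comm (f g : ℝ[X]) : jacobiForm m f g = jacobiForm m g f := by
  simp only [apply, mul_comm (eval _ f)]

/-- There is a polynomial of degree `n` that is orthogonal to all polynomials of smaller degree. -/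
theorem exists_orthogonal (n : ℕ) :
    ∃ J : ℝ[X], J ≠ 0 ∧ J.natDegree = n ∧ ∀ g : ℝ[X], g.degree < n → jacobiForm m J g = 0 := by
  let Φ : degreeLT ℝ (n + 1) →ₗ[ℝ] Module.Dual ℝ (degreeLT ℝ n) :=
    (LinearMap.lcomp ℝ ℝ (degreeLT ℝ n).subtype) ∘ₗ (jacobiForm m) ∘ₗ (degreeLT ℝ (n + 1)).subtype
  have hfr (k : ℕ) : Module.finrank ℝ (degreeLT ℝ k) = k := by
    simpa using (degreeLTEquiv ℝ k).finrank_eq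
  have (k : ℕ) : Module.Finite ℝ (degreeLT ℝ k) := Module.Finite.equiv (degreeLTEquiv ℝ k).symm
  -- Being orthogonal to degree below `n` is `n` linear conditions on a space of dimension `n + 1`.
  have hker : LinearMap.ker Φ ≠ ⊥ := by
    apply LinearMap.ker_ne_bot_of_finrank_lt
    rw [Subspace.dual_finrank_eq, hfr, hfr]
    omega
  obtain ⟨⟨J, hJd⟩, hJ, hJ0⟩ := (Submodule.ne_bot_iff _).1 hker
  have hJ0' : J ≠ 0 := fun h => hJ0 (Subtype.ext h)
  have horth (g : ℝ[X]) (hg : g.degree < n) : jacobiForm m J g = 0 :=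
    LinearMap.congr_fun (LinearMap.mem_ker.1 hJ) ⟨g, mem_degreeLT.2 hg⟩
  refine ⟨J, hJ0', ?_, horth⟩
  have h1 : J.natDegree < n + 1 := (natDegree_lt_iff_degree_lt hJ0').2 (mem_degreeLT.1 hJd)
  by_contra hne
  have h2 : J.degree < n := (natDegree_lt_iff_degree_lt hJ0').1 (by omega)
  exact (self_pos m hJ0').ne' (horth J h2)

/-- Integrate `(r^(m+1) J²)'` over `[0, 1]`. In the cross term, `X J'` may be replaced by `n J`,
because the leading terms of `X J' - n J` cancel and `J` is orthogonal to what is left. -/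
theorem sq_eval_one_of_orthogonal {n : ℕ} {J : ℝ[X]} (hJ : J.natDegree = n)
    (horth : ∀ g : ℝ[X], g.degree < n → jacobiForm m J g = 0) :
    J.eval 1 ^ 2 = (2 * n + m + 1) * jacobiForm m J J := by
  have h1 : jacobiForm m J (X * derivative J) = n * jacobiForm m J J := by
    have hdeg : (X * derivative J - C (n : ℝ) * J).degree < (n : WithBot ℕ) := by
      rw [degree_lt_iff_coeff_zero]
      intro k hk
      rcases k with - | k
      · have : n = 0 := by omega
        simp [this]
      · rw [coeff_sub, coeff_X_mul, coeff_C_mul, coeff_derivative]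
        rcases hk.eq_or_lt with h | h
        · rw [h]; push_cast; ring
        · rw [coeff_eq_zero_of_natDegree_lt (by omega)]; ring
    have := horth _ hdeg
    rw [map_sub, C_mul', map_smul, smul_eq_mul] at this
    linarith
  have h2 : ∫ r in (0 : ℝ)..1, (derivative (X ^ (m + 1) * J ^ 2)).eval r = J.eval 1 ^ 2 := by
    rw [intervalIntegral.integral_eq_sub_of_hasDerivAt
      (fun r _ => (X ^ (m + 1) * J ^ 2).hasDerivAt r)
      (Continuous.intervalIntegrable (by fun_prop) _ _)]
    simp
  have h3 : ∫ r in (0 : ℝ)..1, (derivative (X ^ (m + 1) * J ^ 2)).eval r =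
      (m + 1) * jacobiForm m J J + 2 * jacobiForm m J (X * derivative J) := by
    rw [apply, apply, ← intervalIntegral.integral_const_mul, ← intervalIntegral.integral_const_mul,
      ← intervalIntegral.integral_add (Continuous.intervalIntegrable (by fun_prop) _ _)
        (Continuous.intervalIntegrable (by fun_prop) _ _)]
    congr 1; ext r
    simp [derivative_mul, derivative_pow]
    ring
  rw [← h2, h3, h1]
  ring

/-- The sharp endpoint evaluation bound for the weight `r ^ m` on `[0, 1]`. -/
theorem sq_eval_one_le (p : ℕ) (f : ℝ[X]) (hf : f.natDegree ≤ p) :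
    f.eval 1 ^ 2 ≤ (p + 1) * (p + (m + 1 : ℕ)) * jacobiForm m f f := by
  -- With `n = p + 1`, the constant `n (n + m)` is the sum of `2j + m + 1` over `j < n`, and the
  -- induction starts at `f = 0`.
  suffices H : ∀ n : ℕ, ∀ f : ℝ[X], f.degree < n →
      f.eval 1 ^ 2 ≤ n * (n + m) * jacobiForm m f f by
    have := H (p + 1) f (lt_of_le_of_lt degree_le_natDegree (by exact_mod_cast Nat.lt_succ_of_le hf))
    push_cast at this ⊢
    linarith
  intro n
  induction n with
  | zero =>
    intro f hf
    have : f = 0 := by simpa using hf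
    simp [this]
  | succ n ih =>
    intro f hf
    obtain ⟨J, hJ0, hJn, horth⟩ := exists_orthogonal m n
    have hJ1 := sq_eval_one_of_orthogonal m hJn horth
    set c : ℝ := f.coeff n / J.coeff n with hc
    have hJc : J.coeff n ≠ 0 := by
      rw [← hJn]; exact leadingCoeff_ne_zero.2 hJ0
    set g := f - C c * J with hg
    have hgdeg : g.degree < n := by
      rw [degree_lt_iff_coeff_zero]
      intro k hk
      rw [hg, coeff_sub, coeff_C_mul]
      rcases hk.eq_or_lt with h | h
      · rw [← h, hc]; field_simp; ring
      · rw [(degree_lt_iff_coeff_zero _ _).1 hf k h,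
          coeff_eq_zero_of_natDegree_lt (p := J) (by omega)]
        ring
    have hfg : f = g + c • J := by rw [hg, C_mul']; ring
    have hip : jacobiForm m f f = jacobiForm m g g + c ^ 2 * jacobiForm m J J := by
      rw [hfg]
      simp only [map_add, map_smul, LinearMap.add_apply, LinearMap.smul_apply, smul_eq_mul,
        comm m g J, horth g hgdeg]
      ring
    have hgi := ih g hgdeg
    have hev : f.eval 1 = g.eval 1 + c * J.eval 1 := by rw [hfg]; simp
    have hgn := self_nonneg m g
    have hJp := self_pos m hJ0
    rw [hip, hev]
    set A := jacobiForm m g g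
    set D := jacobiForm m J J
    set x := g.eval 1
    set y := J.eval 1
    push_cast
    have e1 : (c * y) ^ 2 = (2 * n + m + 1) * (c ^ 2 * D) := by rw [mul_pow, hJ1]; ring
    have hN : (0 : ℝ) ≤ n * (n + m) := by positivity
    have hS : (0 : ℝ) < 2 * n + m + 1 := by positivity
    -- The cross term by AM-GM; the weights are chosen because `n(n+m) + (2n+m+1) = (n+1)(n+1+m)`.
    have key : 2 * x * (c * y) ≤ (2 * n + m + 1) * A + n * (n + m) * (c ^ 2 * D) := by
      have hcD : 0 ≤ c ^ 2 * D := by positivity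
      have hsq : (x * (c * y)) ^ 2 ≤
          ((2 * n + m + 1) * A) * (n * (n + m) * (c ^ 2 * D)) := by
        rw [mul_pow, e1]
        calc x ^ 2 * ((2 * n + m + 1) * (c ^ 2 * D))
            ≤ (n * (n + m) * A) * ((2 * n + m + 1) * (c ^ 2 * D)) := by gcongr
          _ = _ := by ring
      have h4 := sq_nonneg ((2 * n + m + 1) * A - n * (n + m) * (c ^ 2 * D))
      refine le_of_sq_le_sq ?_ (by positivity) |>.trans' (by rw [mul_assoc])
      nlinarith
    nlinarith
end jacobiForm

/-! ### Integration over prisms and cones by hyperplane slices -/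

section Slicing

open Module Set

variable {E : Type*} [NormedAddCommGroup E] [InnerProductSpace ℝ E]

theorem mem_orthogonal_span_singleton_iff {n x : E} : x ∈ (ℝ ∙ n)ᗮ ↔ inner ℝ n x = 0 :=
  Submodule.mem_orthogonal_singleton_iff_inner_right

/-- The set swept out by `F` under translation by the vectors `s • e`, `0 ≤ s ≤ t`. -/
def sweep (F : Set E) (e : E) (t : ℝ) : Set E := {x | ∃ s ∈ Icc 0 t, x - s • e ∈ F}

/-- The cone with base `F` and apex `a`. -/
def coneOver (a : E) (F : Set E) : Set E := {x | ∃ r ∈ Icc (0 : ℝ) 1, ∃ y ∈ F, x = a + r • (y - a)}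

theorem isCompact_sweep {F : Set E} (hF : IsCompact F) (e : E) (t : ℝ) :
    IsCompact (sweep F e t) := by
  have : sweep F e t = (fun q : ℝ × E => q.2 + q.1 • e) '' (Icc 0 t ×ˢ F) := by
    ext x
    constructor
    · rintro ⟨s, hs, hx⟩
      exact ⟨(s, x - s • e), ⟨hs, hx⟩, by simp⟩
    · rintro ⟨⟨s, y⟩, ⟨hs, hy⟩, rfl⟩
      exact ⟨s, hs, by simpa using hy⟩
  rw [this]
  exact (isCompact_Icc.prod hF).image (by fun_prop)

theorem isCompact_coneOver {F : Set E} (hF : IsCompact F) (a : E) : IsCompact (coneOver a F) := by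
  have : coneOver a F = (fun q : ℝ × E => a + q.1 • (q.2 - a)) '' (Icc 0 1 ×ˢ F) := by
    ext x
    constructor
    · rintro ⟨r, hr, y, hy, rfl⟩
      exact ⟨(r, y), ⟨hr, hy⟩, rfl⟩
    · rintro ⟨⟨r, y⟩, ⟨hr, hy⟩, rfl⟩
      exact ⟨r, hr, y, hy, rfl⟩
  rw [this]
  exact (isCompact_Icc.prod hF).image (by fun_prop)

variable {V : Type*} [NormedAddCommGroup V] [NormedSpace ℝ V] [FiniteDimensional ℝ V]
  [MeasurableSpace V] [BorelSpace V]

theorem lintegral_eq_mul_lintegral_comp_smul (μ : Measure V) [μ.IsAddHaarMeasure] {r : ℝ}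
    (hr : r ≠ 0) (f : V → ENNReal) :
    ∫⁻ y, f y ∂μ = ENNReal.ofReal (|r| ^ finrank ℝ V) * ∫⁻ y, f (r • y) ∂μ := by
  have h := (Homeomorph.smulOfNeZero r hr : V ≃ₜ V).measurableEmbedding.lintegral_map (μ := μ) f
  simp only [Homeomorph.smulOfNeZero_apply] at h
  rw [← h]
  change _ = _ * ∫⁻ y, f y ∂(μ.map (r • ·))
  rw [Measure.map_addHaar_smul μ hr, lintegral_smul_measure, smul_eq_mul, ← mul_assoc,
    ← ENNReal.ofReal_mul (by positivity), abs_inv, abs_pow,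
    mul_inv_cancel₀ (by positivity), ENNReal.ofReal_one, one_mul]

variable [FiniteDimensional ℝ E]
  [MeasurableSpace E] [BorelSpace E]

theorem volume_eq_lintegral_hyperplane_slices (p : E) {n : E} (hn : ‖n‖ = 1) {f : E → ENNReal}
    (hf : Measurable f) :
    ∫⁻ x, f x = ∫⁻ z : ℝ, ∫⁻ y : (ℝ ∙ n)ᗮ, f ((y + z • n) + p) := by
  have h1 := ((ℝ ∙ n)ᗮ.measurePreserving_measurableEquivProd p).symm
  rw [InnerProductSpace.euclideanHausdorffMeasure_eq_volume] at h1
  let e : ℝ ≃ₗᵢ[ℝ] (ℝ ∙ n)ᗮᗮ := (LinearIsometryEquiv.toSpanUnitSingleton n hn).trans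
    (LinearIsometryEquiv.ofEq _ _ (Submodule.orthogonal_orthogonal _).symm)
  rw [← h1.lintegral_comp_emb (MeasurableEquiv.measurableEmbedding _), Measure.volume_eq_prod,
    lintegral_prod_symm' (fun q => f (((ℝ ∙ n)ᗮ.measurableEquivProd p).symm q))
      (hf.comp (MeasurableEquiv.measurable _)),
    ← e.measurePreserving.lintegral_comp_emb e.toHomeomorph.measurableEmbedding]
  rfl

/-- Translation by `p` embeds `nᗮ` isometrically, so it carries Lebesgue measure there to surface
measure on the hyperplane. All surface integrals become integrals over one fixed vector space. -/
theorem lintegral_hausdorff_of_subset_hyperplane {m : ℕ} (hm : finrank ℝ E = m + 1) {p n : E}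
    (hn : ‖n‖ = 1) {F : Set E} (hF : MeasurableSet F) (hFn : ∀ x ∈ F, inner ℝ n (x - p) = 0)
    (f : E → ENNReal) :
    ∫⁻ x in F, f x ∂μHE[m] = ∫⁻ y : (ℝ ∙ n)ᗮ, F.indicator f (y + p) := by
  have hn0 : n ≠ 0 := by rintro rfl; simp at hn
  have : Fact (finrank ℝ E = m + 1) := ⟨hm⟩
  have hfr : finrank ℝ (ℝ ∙ n)ᗮ = m := Submodule.finrank_orthogonal_span_singleton hn0
  have hiso : Isometry (fun y : (ℝ ∙ n)ᗮ => (y : E) + p) :=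
    (IsometryEquiv.addRight p).isometry.comp isometry_subtype_coe
  have hvol : (μHE[m] : Measure (ℝ ∙ n)ᗮ) = volume := by
    conv_lhs => rw [← hfr]
    exact InnerProductSpace.euclideanHausdorffMeasure_eq_volume
  have hmap := hiso.map_euclideanHausdorffMeasure (d := m)
  rw [hvol] at hmap
  have hsub : F ⊆ range (fun y : (ℝ ∙ n)ᗮ => (y : E) + p) := fun x hx =>
    ⟨⟨x - p, mem_orthogonal_span_singleton_iff.2 (hFn x hx)⟩, by simp⟩
  rw [← Measure.restrict_restrict_of_subset hsub, ← hmap, ← lintegral_indicator hF,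
    hiso.isClosedEmbedding.measurableEmbedding.lintegral_map]

/-- The slice of the swept prism at height `z` is `F` translated by `s • e` with `z = s ⟨n, e⟩`, and
such `z` fill an interval of length `|⟨n, e⟩| t`. -/
theorem setLIntegral_sweep_le {m : ℕ} (hm : finrank ℝ E = m + 1) {p n : E}
    (hn : ‖n‖ = 1) {F : Set E} (hF : IsCompact F) (hFn : ∀ x ∈ F, inner ℝ n (x - p) = 0)
    (e : E) {t : ℝ} {f g : E → ENNReal} (hf : Measurable f)
    (hfg : ∀ x ∈ F, ∀ s ∈ Icc 0 t, f (x + s • e) ≤ g x) :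
    ∫⁻ x in sweep F e t, f x ≤
      ENNReal.ofReal (|inner ℝ n e| * t) * ∫⁻ x in F, g x ∂μHE[m] := by
  have hP := (isCompact_sweep hF e t).measurableSet
  have hnn : inner ℝ n n = (1 : ℝ) := by rw [real_inner_self_eq_norm_sq, hn, one_pow]
  rw [← lintegral_indicator hP, volume_eq_lintegral_hyperplane_slices p hn (hf.indicator hP),
    lintegral_hausdorff_of_subset_hyperplane hm hn hF.measurableSet hFn]
  set c : ℝ := inner ℝ n e with hc
  have hz (z : ℝ) (y : (ℝ ∙ n)ᗮ) (s : ℝ) (h : ((y : E) + z • n) + p - s • e ∈ F) : z = s * c := by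
    have h1 := hFn _ h
    have h2 := mem_orthogonal_span_singleton_iff.1 y.2
    have : (y : E) + z • n + p - s • e - p = y + z • n - s • e := by abel
    rw [this, inner_sub_right, inner_add_right, inner_smul_right, inner_smul_right, h2, hnn,
      ← hc] at h1
    linarith
  rcases eq_or_ne c 0 with hc0 | hc0
  -- If `e` is parallel to the hyperplane, the sweep stays in the single slice `z = 0`.
  · refine le_of_eq_of_le ?_ (zero_le)
    rw [lintegral_eq_zero_iff' ?_]
    · have : ∀ᵐ z : ℝ, z ≠ 0 := by simp [ae_iff]
      filter_upwards [this] with z hz0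
      rw [Pi.zero_apply, ← lintegral_zero]
      congr 1; ext y
      refine indicator_of_notMem ?_ _
      rintro ⟨s, -, hx⟩
      exact hz0 (by rw [hz z y s hx, hc0, mul_zero])
    · have : Measurable fun q : ℝ × (ℝ ∙ n)ᗮ =>
          (sweep F e t).indicator f ((q.2 + q.1 • n) + p) :=
        (hf.indicator hP).comp (by fun_prop)
      exact this.lintegral_prod_right'.aemeasurable
  set G : ENNReal := ∫⁻ y : (ℝ ∙ n)ᗮ, F.indicator g (y + p) with hG
  set S : Set ℝ := (fun z => z * c⁻¹) ⁻¹' Icc 0 t with hS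
  have hSm : MeasurableSet S := measurableSet_Icc.preimage (by fun_prop)
  calc ∫⁻ z : ℝ, ∫⁻ y : (ℝ ∙ n)ᗮ, (sweep F e t).indicator f ((y + z • n) + p)
      ≤ ∫⁻ z : ℝ, S.indicator (fun _ => G) z := by
        refine lintegral_mono fun z => ?_
        -- The tangential part of `s • e` for `s = z / c`; shifting by it moves the slice back onto
        -- `F`.
        let w : (ℝ ∙ n)ᗮ := (z * c⁻¹) • ⟨e - c • n, by
          rw [mem_orthogonal_span_singleton_iff, inner_sub_right, inner_smul_right, hnn, hc]
          ring⟩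
        have hw : (w : E) = (z * c⁻¹) • e - z • n := by
          simp only [w, Submodule.coe_smul, smul_sub, smul_smul]
          rw [inv_mul_cancel_right₀ hc0]
        have hpt (y : (ℝ ∙ n)ᗮ) : (sweep F e t).indicator f ((y + z • n) + p) ≤
            S.indicator (fun _ => F.indicator g ((y - w : (ℝ ∙ n)ᗮ) + p)) z := by
          by_cases hx : ((y : E) + z • n) + p ∈ sweep F e t
          swap
          · rw [indicator_of_notMem hx]; exact zero_le
          rw [indicator_of_mem hx]
          obtain ⟨s, hs, hx⟩ := hx
          have hzs := hz z y s hx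
          have hs' : z * c⁻¹ = s := by rw [hzs, mul_inv_cancel_right₀ hc0]
          have hxy : ((y - w : (ℝ ∙ n)ᗮ) : E) + p = y + z • n + p - s • e := by
            rw [Submodule.coe_sub, hw, hs']; abel
          rw [indicator_of_mem (by rw [hS, mem_preimage, hs']; exact hs), hxy,
            indicator_of_mem hx]
          simpa using hfg _ hx s hs
        refine (lintegral_mono hpt).trans ?_
        by_cases hzS : z ∈ S
        · simp only [indicator_of_mem hzS]
          rw [lintegral_sub_right_eq_self (fun y : (ℝ ∙ n)ᗮ => F.indicator g (y + p))]
        · simp [indicator_of_notMem hzS]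
    _ = ENNReal.ofReal (|c| * t) * G := by
        rw [lintegral_indicator hSm, setLIntegral_const, hS,
          Real.volume_preimage_mul_right (inv_ne_zero hc0), inv_inv, Real.volume_Icc, sub_zero,
          ENNReal.ofReal_mul (abs_nonneg _), mul_comm]

/-- The slice at height `(1 - r) ⟨n, a - p⟩` is `F` shrunk towards the apex by the factor `r`, which
contributes the Jacobian `r ^ m`. -/
theorem setLIntegral_coneOver {m : ℕ} (hm : finrank ℝ E = m + 1) {p n a : E}
    (hn : ‖n‖ = 1) {F : Set E} (hF : IsCompact F) (hFn : ∀ x ∈ F, inner ℝ n (x - p) = 0)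
    (ha : inner ℝ n (a - p) ≠ 0) {f : E → ENNReal} (hf : Measurable f) :
    ∫⁻ x in coneOver a F, f x = ENNReal.ofReal |inner ℝ n (a - p)| *
      ∫⁻ r in Ioo (0 : ℝ) 1, ENNReal.ofReal (r ^ m) *
        ∫⁻ x in F, f (a + r • (x - a)) ∂μHE[m] := by
  have hP := (isCompact_coneOver hF a).measurableSet
  have hn0 : n ≠ 0 := by rintro rfl; simp at hn
  have : Fact (finrank ℝ E = m + 1) := ⟨hm⟩
  have hfr : finrank ℝ (ℝ ∙ n)ᗮ = m := Submodule.finrank_orthogonal_span_singleton hn0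
  have hnn : inner ℝ n n = (1 : ℝ) := by rw [real_inner_self_eq_norm_sq, hn, one_pow]
  rw [← lintegral_indicator hP, volume_eq_lintegral_hyperplane_slices p hn (hf.indicator hP)]
  set H : ℝ := inner ℝ n (a - p) with hH
  have hcone (r : ℝ) (y : E) (hy : inner ℝ n (y - p) = 0) (h : a + r • (y - a) ∈ coneOver a F) :
      r ∈ Icc 0 1 ∧ (r ≠ 0 → y ∈ F) := by
    obtain ⟨r', hr', y', hy', h⟩ := h
    have h1 : r • (y - a) = r' • (y' - a) := add_left_cancel h
    have h2 : ∀ u : E, inner ℝ n (u - p) = 0 → inner ℝ n (u - a) = -H := by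
      intro u hu
      rw [show u - a = (u - p) - (a - p) by abel, inner_sub_right, hu, hH]; ring
    have h3 := congrArg (inner ℝ n) h1
    rw [inner_smul_right, inner_smul_right, h2 y hy, h2 y' (hFn y' hy')] at h3
    have h4 : r = r' := mul_right_cancel₀ (neg_ne_zero.2 ha) h3
    subst h4
    refine ⟨hr', fun hr0 => ?_⟩
    have := sub_left_injective (smul_right_injective E hr0 h1)
    rwa [this]
  -- The foot of the perpendicular from the apex, with `p` as origin.
  let a' : (ℝ ∙ n)ᗮ := ⟨a - p - H • n, by
    rw [mem_orthogonal_span_singleton_iff, inner_sub_right, inner_smul_right, hnn, ← hH]; ring⟩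
  have hyp (y : (ℝ ∙ n)ᗮ) : inner ℝ n (((y : E) + p) - p) = 0 := by
    rw [add_sub_cancel_right]; exact mem_orthogonal_span_singleton_iff.1 y.2
  -- Substitute `z = H (1 - r)`, so that `r = 1` is the base and `r = 0` the apex.
  rw [lintegral_eq_mul_lintegral_comp_smul volume ha, finrank_self, pow_one,
    ← lintegral_sub_left_eq_self (fun r : ℝ => ∫⁻ y : (ℝ ∙ n)ᗮ,
      (coneOver a F).indicator f ((y + (H • r) • n) + p)) 1, ← lintegral_indicator measurableSet_Ioo]
  congr 1
  refine lintegral_congr_ae ?_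
  have h01 : ∀ᵐ r : ℝ, r ≠ 0 ∧ r ≠ 1 := by
    rw [Filter.eventually_and]; constructor <;> simp [ae_iff]
  filter_upwards [h01] with r hr
  have hpt (y : (ℝ ∙ n)ᗮ) : (((r • y + (1 - r) • a' : (ℝ ∙ n)ᗮ) : E) + (H • (1 - r)) • n) + p =
      a + r • ((y + p) - a) := by
    simp only [Submodule.coe_add, Submodule.coe_smul, a', smul_eq_mul]
    module
  rw [← lintegral_add_right_eq_self _ ((1 - r) • a'),
    lintegral_eq_mul_lintegral_comp_smul volume hr.1, hfr]
  simp only [hpt]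
  by_cases hr1 : r ∈ Ioo (0 : ℝ) 1
  · rw [indicator_of_mem hr1, abs_of_pos hr1.1,
      lintegral_hausdorff_of_subset_hyperplane hm hn hF.measurableSet hFn]
    congr 2; ext y
    by_cases hy : (y : E) + p ∈ F
    · rw [indicator_of_mem hy, indicator_of_mem (show _ ∈ coneOver a F from ⟨r, ⟨hr1.1.le, hr1.2.le⟩, _, hy, rfl⟩)]
    · rw [indicator_of_notMem hy, indicator_of_notMem]
      exact fun h => hy ((hcone r _ (hyp y) h).2 hr.1)
  · rw [indicator_of_notMem hr1]
    have : ∀ y : (ℝ ∙ n)ᗮ, (coneOver a F).indicator f (a + r • ((y + p) - a)) = 0 := by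
      refine fun y => indicator_of_notMem (fun h => hr1 ?_) _
      have h' := (hcone r _ (hyp y) h).1
      exact ⟨lt_of_le_of_ne h'.1 hr.1.symm, lt_of_le_of_ne h'.2 hr.2⟩
    simp [this]

end Slicing

/-! ### The trace inequality on a cone -/

section TraceInequality

open Module Set

variable {E : Type*} [NormedAddCommGroup E] [InnerProductSpace ℝ E] [FiniteDimensional ℝ E]
  [MeasurableSpace E] [BorelSpace E]

theorem hausdorff_lt_top_of_subset_hyperplane {m : ℕ} (hm : finrank ℝ E = m + 1) {p n : E}
    (hn : ‖n‖ = 1) {F : Set E} (hF : IsCompact F) (hFn : ∀ x ∈ F, inner ℝ n (x - p) = 0) :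
    μHE[m] F < ⊤ := by
  have hiso : Isometry (fun y : (ℝ ∙ n)ᗮ => (y : E) + p) :=
    (IsometryEquiv.addRight p).isometry.comp isometry_subtype_coe
  have hc : IsCompact ((fun y : (ℝ ∙ n)ᗮ => (y : E) + p) ⁻¹' F) :=
    hiso.isClosedEmbedding.isCompact_preimage hF
  have h := lintegral_hausdorff_of_subset_hyperplane hm hn hF.measurableSet hFn (fun _ => 1)
  rw [setLIntegral_const, one_mul] at h
  rw [h]
  change ∫⁻ y : (ℝ ∙ n)ᗮ, ((fun y : (ℝ ∙ n)ᗮ => (y : E) + p) ⁻¹' F).indicator (fun _ => 1) y < ⊤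
  rw [lintegral_indicator hc.measurableSet, setLIntegral_const, one_mul]
  exact hc.measure_lt_top

theorem setLIntegral_Ioo_ofReal {φ : ℝ → ℝ} (hφ : Continuous φ) (h0 : ∀ r ∈ Ioo (0 : ℝ) 1, 0 ≤ φ r) :
    ∫⁻ r in Ioo (0 : ℝ) 1, ENNReal.ofReal (φ r) = ENNReal.ofReal (∫ r in (0 : ℝ)..1, φ r) := by
  rw [intervalIntegral.integral_of_le zero_le_one, integral_Ioc_eq_integral_Ioo,
    ofReal_integral_eq_lintegral_ofReal]
  · exact (hφ.integrableOn_Icc (a := 0) (b := 1)).mono_set Ioo_subset_Icc_self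
  · exact (ae_restrict_iff' measurableSet_Ioo).2 (Filter.Eventually.of_forall h0)

theorem volume_coneOver {m : ℕ} (hm : finrank ℝ E = m + 1) {p n a : E}
    (hn : ‖n‖ = 1) {F : Set E} (hF : IsCompact F) (hFn : ∀ x ∈ F, inner ℝ n (x - p) = 0)
    (ha : inner ℝ n (a - p) ≠ 0) :
    (m + 1) * volume.real (coneOver a F) =
      |inner ℝ n (a - p)| * (μHE[m] : Measure E).real F := by
  have h := setLIntegral_coneOver hm hn hF hFn ha (f := fun _ => 1) measurable_const
  simp only [setLIntegral_const, one_mul] at h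
  rw [lintegral_mul_const _ (by fun_prop),
    setLIntegral_Ioo_ofReal (by fun_prop) (fun r hr => pow_nonneg hr.1.le _)] at h
  rw [Measure.real, h, ENNReal.toReal_mul, ENNReal.toReal_mul, ENNReal.toReal_ofReal (abs_nonneg _),
    integral_pow, ENNReal.toReal_ofReal (by simp; positivity), Measure.real]
  simp
  field_simp

/-- The sharp trace inverse inequality for a function that restricts to polynomials of degree at
most `k` on the lines through the apex of a cone. -/
theorem trace_inverse_inequality {m : ℕ} (hm : finrank ℝ E = m + 1) {p n a : E}
    (hn : ‖n‖ = 1) {F : Set E} (hF : IsCompact F) (hFn : ∀ x ∈ F, inner ℝ n (x - p) = 0)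
    (ha : inner ℝ n (a - p) ≠ 0) {q : E → ℝ} (hq : Continuous q) {k : ℕ}
    (hpoly : ∀ x, ∃ f : Polynomial ℝ, f.natDegree ≤ k ∧ ∀ r : ℝ, q (a + r • (x - a)) = f.eval r) :
    ENNReal.ofReal |inner ℝ n (a - p)| * ∫⁻ x in F, ENNReal.ofReal (q x ^ 2) ∂μHE[m] ≤
      ENNReal.ofReal ((k + 1) * (k + (m + 1 : ℕ))) *
        ∫⁻ x in coneOver a F, ENNReal.ofReal (q x ^ 2) := by
  have : IsFiniteMeasure ((μHE[m] : Measure E).restrict F) :=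
    ⟨by simpa using hausdorff_lt_top_of_subset_hyperplane hm hn hF hFn⟩
  rw [setLIntegral_coneOver hm hn hF hFn ha (by fun_prop), mul_left_comm]
  gcongr
  -- The one-dimensional bound on the ray from the apex through `x`; integrating it over `F`
  -- finishes by Tonelli.
  have hpt (x : E) : ENNReal.ofReal (q x ^ 2) ≤ ENNReal.ofReal ((k + 1) * (k + (m + 1 : ℕ))) *
      ∫⁻ r in Ioo (0 : ℝ) 1, ENNReal.ofReal (r ^ m) * ENNReal.ofReal (q (a + r • (x - a)) ^ 2) := by
    obtain ⟨f, hf, hfq⟩ := hpoly x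
    have h1 : q x = f.eval 1 := by rw [← hfq 1]; simp
    have h2 : ∫⁻ r in Ioo (0 : ℝ) 1,
        ENNReal.ofReal (r ^ m) * ENNReal.ofReal (q (a + r • (x - a)) ^ 2) =
        ENNReal.ofReal (jacobiForm m f f) := by
      rw [jacobiForm.apply, ← setLIntegral_Ioo_ofReal (by fun_prop)
        (fun r hr => mul_nonneg (pow_nonneg hr.1.le _) (mul_self_nonneg _))]
      refine setLIntegral_congr_fun measurableSet_Ioo fun r hr => ?_
      rw [← ENNReal.ofReal_mul (pow_nonneg hr.1.le _), hfq, sq]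
    rw [h2, ← ENNReal.ofReal_mul (by positivity), h1]
    exact ENNReal.ofReal_le_ofReal (jacobiForm.sq_eval_one_le m k f hf)
  refine (lintegral_mono hpt).trans_eq ?_
  rw [lintegral_const_mul' _ _ ENNReal.ofReal_ne_top, lintegral_lintegral_swap]
  · congr 1
    refine lintegral_congr fun r => ?_
    rw [lintegral_const_mul' _ _ ENNReal.ofReal_ne_top]
  · refine Measurable.aemeasurable ?_
    have : Continuous (fun z : E × ℝ => z.2 ^ m) := by fun_prop
    have h' : Continuous (fun z : E × ℝ => q (a + z.2 • (z.1 - a)) ^ 2) := by fun_prop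
    exact this.measurable.ennreal_ofReal.mul h'.measurable.ennreal_ofReal

end TraceInequality

/-! ### A one-sided divergence theorem by translation -/

section Divergence

open Module Set Filter Topology

theorem nonempty_inter_frontier_of_isPreconnected {X : Type*} [TopologicalSpace X] {s t : Set X}
    (ht : IsPreconnected t) (h1 : (t ∩ s).Nonempty) (h2 : (t ∩ sᶜ).Nonempty) :
    (t ∩ frontier s).Nonempty := by
  by_contra hne
  have hd (x : X) (hx : x ∈ t) (hc : x ∈ closure s) : x ∈ interior s := by
    by_contra hi
    exact hne ⟨x, hx, hc, hi⟩
  obtain ⟨x, hxt, hxs⟩ := h1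
  obtain ⟨y, hyt, hys⟩ := h2
  obtain ⟨z, -, hz1, hz2⟩ := ht (interior s) (closure s)ᶜ isOpen_interior isClosed_closure.isOpen_compl
    (fun z hz => (em (z ∈ closure s)).imp (hd z hz) id) ⟨x, hxt, hd x hxt (subset_closure hxs)⟩
    ⟨y, hyt, fun hy => hys (interior_subset (hd y hyt hy))⟩
  exact hz2 (subset_closure (interior_subset hz1))

variable {E : Type*} [NormedAddCommGroup E] [InnerProductSpace ℝ E]

/-- A segment with one end in `κ` and the other outside meets the frontier, hence a face. -/
theorem mem_iUnion_sweep_of_frontier_subset {ι : Type*} {κ : Set E} {F : ι → Set E}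
    (hfr : frontier κ ⊆ ⋃ i, F i) {e x : E} {t : ℝ} (ht : 0 ≤ t)
    (hx : ¬(x ∈ κ ↔ x - t • e ∈ κ)) : ∃ i, x ∈ sweep (F i) e t := by
  have hpre : IsPreconnected ((fun s : ℝ => x - s • e) '' Icc 0 t) :=
    isPreconnected_Icc.image _ (by fun_prop)
  have h0 : x ∈ (fun s : ℝ => x - s • e) '' Icc 0 t := ⟨0, ⟨le_rfl, ht⟩, by simp⟩
  have h1 : x - t • e ∈ (fun s : ℝ => x - s • e) '' Icc 0 t := ⟨t, ⟨ht, le_rfl⟩, rfl⟩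
  have : (((fun s : ℝ => x - s • e) '' Icc 0 t) ∩ frontier κ).Nonempty := by
    by_cases hxκ : x ∈ κ
    · exact nonempty_inter_frontier_of_isPreconnected hpre ⟨x, h0, hxκ⟩ ⟨_, h1, fun h => hx (by tauto)⟩
    · exact nonempty_inter_frontier_of_isPreconnected hpre ⟨_, h1, by tauto⟩ ⟨x, h0, hxκ⟩
  obtain ⟨_, ⟨s, hs, rfl⟩, hsf⟩ := this
  obtain ⟨i, hi⟩ := mem_iUnion.1 (hfr hsf)
  exact ⟨i, s, hs, hi⟩

variable [FiniteDimensional ℝ E] [MeasurableSpace E] [BorelSpace E]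

/-- A one-sided form of the divergence theorem: the integral of a directional derivative over a
bounded open set whose boundary is covered by finitely many compact subsets of hyperplanes is at
most the sum of the surface integrals, weighted by the components of the normals. -/
theorem enorm_setIntegral_fderiv_le {ι : Type*} [Fintype ι] {m : ℕ} (hm : finrank ℝ E = m + 1)
    {κ : Set E} (hκ : IsOpen κ) (hκb : Bornology.IsBounded κ) {F : ι → Set E} {p n : ι → E}
    (hn : ∀ i, ‖n i‖ = 1) (hF : ∀ i, IsCompact (F i))
    (hFn : ∀ i, ∀ x ∈ F i, inner ℝ (n i) (x - p i) = 0) (hfr : frontier κ ⊆ ⋃ i, F i)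
    {g : E → ℝ} (hg : ContDiff ℝ 1 g) (e : E) :
    ‖∫ x in κ, fderiv ℝ g x e‖ₑ ≤
      ∑ i, ENNReal.ofReal |inner ℝ (n i) e| * ∫⁻ x in F i, ‖g x‖ₑ ∂μHE[m] := by
  obtain ⟨R, hR⟩ : ∃ R : ℝ, κ ∪ ⋃ i, F i ⊆ Metric.closedBall 0 R :=
    (hκb.union (isCompact_iUnion hF).isBounded).subset_closedBall 0
  -- Large enough to hold every translate by `s • e` with `|s| ≤ 1`, so `K` bounds the derivative
  -- throughout.
  set B : Set E := Metric.closedBall 0 (R + ‖e‖) with hB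
  have hBc : IsCompact B := isCompact_closedBall _ _
  have hgd : Differentiable ℝ g := hg.differentiable one_ne_zero
  have hgf : Continuous (fderiv ℝ g) := hg.continuous_fderiv one_ne_zero
  have hgc : Continuous g := hg.continuous
  obtain ⟨K, hK⟩ := hBc.exists_bound_of_continuousOn hgf.continuousOn
  have hmem {x : E} (hx : x ∈ κ ∪ ⋃ i, F i) {s : ℝ} (hs : |s| ≤ 1) : x + s • e ∈ B := by
    rw [hB, mem_closedBall_zero_iff]
    refine (norm_add_le _ _).trans (add_le_add (mem_closedBall_zero_iff.1 (hR hx)) ?_)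
    rw [norm_smul, Real.norm_eq_abs]
    exact mul_le_of_le_one_left (norm_nonneg _) hs
  have hlip {x : E} (hx : x ∈ κ ∪ ⋃ i, F i) {s : ℝ} (hs : |s| ≤ 1) :
      ‖g (x + s • e) - g x‖ ≤ K * ‖s • e‖ := by
    have := (convex_closedBall (0 : E) (R + ‖e‖)).norm_image_sub_le_of_norm_fderiv_le
      (fun y _ => hgd y) hK (by simpa using hmem hx (s := 0) (by simp)) (hmem hx hs)
    simpa using this
  have hfin : IsFiniteMeasure (volume.restrict κ) :=
    ⟨by simpa using hκb.measure_lt_top⟩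
  have hint {S : Set E} (hS : S ⊆ B) : IntegrableOn g S :=
    (hgc.continuousOn.integrableOn_compact hBc).mono_set hS
  have hκB : κ ⊆ B := fun x hx => by simpa using hmem (Or.inl hx) (s := 0) (by simp)
  have hder : HasDerivAt (fun t : ℝ => ∫ x in κ, g (x + t • e)) (∫ x in κ, fderiv ℝ g x e) 0 := by
    have := (hasDerivAt_integral_of_dominated_loc_of_deriv_le (μ := volume.restrict κ)
      (F := fun (t : ℝ) x => g (x + t • e)) (F' := fun t x => fderiv ℝ g (x + t • e) e)
      (x₀ := (0 : ℝ)) (bound := fun _ => K * ‖e‖) (Metric.ball_mem_nhds 0 one_pos)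
      (Eventually.of_forall fun t => Continuous.aestronglyMeasurable (by fun_prop))
      (by simpa using! hint hκB) (Continuous.aestronglyMeasurable (by fun_prop)) ?_
      (integrable_const _) ?_).2
    · simpa using! this
    · refine ae_restrict_of_forall_mem hκ.measurableSet fun x hx t ht => ?_
      have ht' : |t| ≤ 1 := by simpa using (Metric.mem_ball.1 ht).le
      exact (ContinuousLinearMap.le_opNorm _ _).trans
        (mul_le_mul_of_nonneg_right (hK _ (hmem (Or.inl hx) ht')) (norm_nonneg _))
    · refine Eventually.of_forall fun x t _ => ?_
      have h1 : HasDerivAt (fun t : ℝ => x + t • e) e t := by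
        simpa using ((hasDerivAt_id t).smul_const e).const_add x
      exact (hgd _).hasFDerivAt.comp_hasDerivAt t h1
  have hlim := hder.tendsto_slope_zero_right.enorm
  -- The majorant of the difference quotient at `t > 0`: its second summand is the Lipschitz error
  -- of replacing `g` on the sweep by its values on the face, and vanishes as `t → 0`.
  refine le_of_tendsto_of_tendsto hlim
    (g := fun t : ℝ => ∑ i, ENNReal.ofReal |inner ℝ (n i) e| *
      (∫⁻ x in F i, ‖g x‖ₑ ∂μHE[m] + ENNReal.ofReal (K * (t * ‖e‖)) * μHE[m] (F i))) ?_ ?_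
  · refine tendsto_finsetSum _ fun i _ => ENNReal.Tendsto.const_mul ?_ (Or.inr ENNReal.ofReal_ne_top)
    have h1 : Tendsto (fun t : ℝ => ENNReal.ofReal (K * (t * ‖e‖)) * μHE[m] (F i)) (𝓝[>] 0)
        (𝓝 (ENNReal.ofReal (K * (0 * ‖e‖)) * μHE[m] (F i))) := by
      refine ENNReal.Tendsto.mul_const (ENNReal.tendsto_ofReal ?_)
        (Or.inr (hausdorff_lt_top_of_subset_hyperplane hm (hn i) (hF i) (hFn i)).ne)
      exact Tendsto.mono_left (Continuous.tendsto (by fun_prop) 0) nhdsWithin_le_nhds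
    simpa using h1.const_add (∫⁻ x in F i, ‖g x‖ₑ ∂μHE[m])
  · filter_upwards [Ioo_mem_nhdsGT (zero_lt_one' ℝ)] with t ht
    set κ' : Set E := {x | x - t • e ∈ κ} with hκ'
    have hκ'm : MeasurableSet κ' := hκ.measurableSet.preimage (by fun_prop)
    have hκ'B : κ' ⊆ B := fun x hx => by
      have := hmem (Or.inl hx) (s := t) (by rw [abs_of_pos ht.1]; exact ht.2.le)
      simpa using this
    have e1 : ∫ x in κ, g (x + t • e) = ∫ x, κ'.indicator g x := by
      rw [← integral_indicator hκ.measurableSet, ← integral_add_right_eq_self (κ'.indicator g) (t • e)]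
      congr 1; ext x
      have : x + t • e ∈ κ' ↔ x ∈ κ := by
        change x + t • e - t • e ∈ κ ↔ _
        rw [add_sub_cancel_right]
      by_cases hx : x ∈ κ
      · rw [indicator_of_mem hx, indicator_of_mem (this.2 hx)]
      · rw [indicator_of_notMem hx, indicator_of_notMem (mt this.1 hx)]
    have e2 : ∫ x in κ, g (x + (0 : ℝ) • e) = ∫ x, κ.indicator g x := by
      rw [integral_indicator hκ.measurableSet]; simp
    have key : ‖(∫ x in κ, g (x + t • e)) - ∫ x in κ, g (x + (0 : ℝ) • e)‖ₑ ≤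
        ∑ i, ENNReal.ofReal (|inner ℝ (n i) e| * t) *
          ∫⁻ x in F i, (‖g x‖ₑ + ENNReal.ofReal (K * (t * ‖e‖))) ∂μHE[m] := by
      rw [e1, e2, ← integral_sub ((integrable_indicator_iff hκ'm).2 (hint hκ'B))
        ((integrable_indicator_iff hκ.measurableSet).2 (hint hκB))]
      have hpt (x : E) : ‖κ'.indicator g x - κ.indicator g x‖ₑ ≤
          ∑ i, (sweep (F i) e t).indicator (fun x => ‖g x‖ₑ) x := by
        by_cases hx : x ∈ κ ↔ x - t • e ∈ κ
        · have : κ'.indicator g x = κ.indicator g x := by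
            by_cases hx' : x ∈ κ
            · rw [indicator_of_mem hx', indicator_of_mem (show x ∈ κ' from hx.1 hx')]
            · rw [indicator_of_notMem hx', indicator_of_notMem (fun h : x ∈ κ' => hx' (hx.2 h))]
          simp [this]
        · obtain ⟨i, hi⟩ := mem_iUnion_sweep_of_frontier_subset hfr ht.1.le hx
          refine le_trans ?_ (Finset.single_le_sum (fun _ _ => zero_le) (Finset.mem_univ i))
          rw [indicator_of_mem hi]
          by_cases hx' : x ∈ κ
          · have h' : x ∉ κ' := fun h => hx ⟨fun _ => h, fun _ => hx'⟩
            simp [indicator_of_mem hx', indicator_of_notMem h']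
          · simp only [indicator_of_notMem hx', sub_zero]
            exact enorm_indicator_le_enorm_self _ _
      have hsw (i : ι) : MeasurableSet (sweep (F i) e t) :=
        (isCompact_sweep (hF i) e t).measurableSet
      refine (enorm_integral_le_lintegral_enorm _).trans ((lintegral_mono hpt).trans ?_)
      rw [lintegral_finsetSum _ fun i _ => (hgc.measurable.enorm.indicator (hsw i))]
      refine Finset.sum_le_sum fun i _ => ?_
      rw [lintegral_indicator (hsw i)]
      refine setLIntegral_sweep_le hm (hn i) (hF i) (hFn i) e hgc.measurable.enorm
        fun x hx s hs => ?_
      have hs1 : |s| ≤ 1 := by rw [abs_of_nonneg hs.1]; exact hs.2.trans ht.2.le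
      have hxF : x ∈ κ ∪ ⋃ i, F i := Or.inr (mem_iUnion.2 ⟨i, hx⟩)
      have hK0 : 0 ≤ K := (norm_nonneg _).trans (hK _ (hmem hxF hs1))
      have h1 : ‖g (x + s • e) - g x‖ ≤ K * (t * ‖e‖) := by
        refine (hlip hxF hs1).trans ?_
        rw [norm_smul, Real.norm_of_nonneg hs.1]
        gcongr
        exact hs.2
      calc ‖g (x + s • e)‖ₑ = ‖g x + (g (x + s • e) - g x)‖ₑ := by congr 1; ring
        _ ≤ ‖g x‖ₑ + ‖g (x + s • e) - g x‖ₑ := enorm_add_le _ _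
        _ ≤ ‖g x‖ₑ + ENNReal.ofReal (K * (t * ‖e‖)) := by
          gcongr
          rw [← ofReal_norm]
          exact ENNReal.ofReal_le_ofReal h1
    rw [zero_add, enorm_smul]
    refine (mul_le_mul_right key _).trans_eq ?_
    rw [Finset.mul_sum]
    refine Finset.sum_congr rfl fun i _ => ?_
    rw [lintegral_add_right _ measurable_const, setLIntegral_const,
      ENNReal.ofReal_mul (abs_nonneg _), Real.enorm_of_nonneg (inv_nonneg.2 ht.1.le),
      mul_comm (ENNReal.ofReal |_|), ← mul_assoc, ← mul_assoc, ← ENNReal.ofReal_mul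
      (inv_nonneg.2 ht.1.le), inv_mul_cancel₀ ht.1.ne', ENNReal.ofReal_one, one_mul]

end Divergence

/-! ### Simplices as cones over their facets -/

section Simplices

open Module Set

variable {E : Type*} [NormedAddCommGroup E] [InnerProductSpace ℝ E]

theorem closedInterior_eq_coneOver {d k : ℕ} (T : Affine.Simplex ℝ E d) (F : Affine.Simplex ℝ E k)
    (i : Fin (d + 1)) (h : T.points '' {i}ᶜ = range F.points) :
    T.closedInterior = coneOver (T.points i) F.closedInterior := by
  have h1 : range T.points = insert (T.points i) (range F.points) := by
    rw [← h, ← image_insert_eq, insert_eq, union_compl_self, image_univ]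
  rw [← T.convexHull_eq_closedInterior, h1, convexHull_insert (range_nonempty _),
    F.convexHull_eq_closedInterior]
  ext x
  simp only [mem_convexJoin, mem_singleton_iff, exists_eq_left, segment_eq_image', coneOver]
  constructor
  · rintro ⟨y, hy, r, hr, rfl⟩
    exact ⟨r, hr, y, hy, rfl⟩
  · rintro ⟨r, hr, y, hy, rfl⟩
    exact ⟨y, hy, r, hr, rfl⟩

/-- Affine independence keeps the apex off the span of the facet, so some vector normal to that span
detects it. The sign of the normal is left open. -/
theorem exists_unit_normal [FiniteDimensional ℝ E] {d k : ℕ} (T : Affine.Simplex ℝ E d)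
    (F : Affine.Simplex ℝ E k) (i : Fin (d + 1)) (h : T.points '' {i}ᶜ = range F.points) :
    ∃ p n : E, ‖n‖ = 1 ∧ (∀ x ∈ F.closedInterior, inner ℝ n (x - p) = 0) ∧
      inner ℝ n (T.points i - p) ≠ 0 := by
  set S := affineSpan ℝ (range F.points) with hS
  have hp : F.points 0 ∈ S := mem_affineSpan ℝ (mem_range_self 0)
  have ha : T.points i ∉ S := by
    rw [hS, ← h]
    have := T.independent.notMem_affineSpan_sdiff i univ
    rwa [← compl_eq_univ_sdiff] at this
  have ha' : T.points i - F.points 0 ∉ S.direction := fun h' =>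
    ha ((AffineSubspace.vsub_right_mem_direction_iff_mem hp _).1 h')
  obtain ⟨w, hw, hwa⟩ : ∃ w ∈ S.directionᗮ, inner ℝ w (T.points i - F.points 0) ≠ 0 := by
    by_contra! hcon
    apply ha'
    rw [← Submodule.orthogonal_orthogonal S.direction, Submodule.mem_orthogonal]
    exact hcon
  have hw0 : w ≠ 0 := by rintro rfl; simp at hwa
  refine ⟨F.points 0, ‖w‖⁻¹ • w, by
    rw [norm_smul, norm_inv, norm_norm, inv_mul_cancel₀ (norm_ne_zero_iff.2 hw0)], fun x hx => ?_, ?_⟩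
  · have : x - F.points 0 ∈ S.direction :=
      AffineSubspace.vsub_mem_direction (F.closedInterior_subset_affineSpan hx) hp
    rw [real_inner_smul_left, Submodule.inner_left_of_mem_orthogonal this hw, mul_zero]
  · rw [real_inner_smul_left]
    exact mul_ne_zero (inv_ne_zero (norm_ne_zero_iff.2 hw0)) hwa

theorem interior_closedInterior_subset [FiniteDimensional ℝ E] {m : ℕ}
    (hm : finrank ℝ E = m + 1) (T : Affine.Simplex ℝ E (m + 1)) :
    interior T.closedInterior ⊆ T.interior := by
  let b : AffineBasis (Fin (m + 1 + 1)) ℝ E := ⟨T.points, T.independent, by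
    rw [T.independent.affineSpan_eq_top_iff_card_eq_finrank_add_one, Fintype.card_fin, hm]⟩
  have hb : interior T.closedInterior = {x | ∀ i, 0 < b.coord i x} := by
    rw [← T.convexHull_eq_closedInterior]
    exact b.interior_convexHull
  rw [hb]
  intro x hx
  refine ⟨fun i => b.coord i x, b.sum_coord_apply_eq_one x, fun i => ⟨hx i, ?_⟩,
    b.affineCombination_coord_eq_self x⟩
  rw [← b.sum_coord_apply_eq_one x]
  obtain ⟨j, hj⟩ := exists_ne i
  exact Finset.single_lt_sum hj (Finset.mem_univ i) (Finset.mem_univ j) (hx j)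
    fun k _ _ => (hx k).le

theorem convex_closedInterior {d : ℕ} (T : Affine.Simplex ℝ E d) : Convex ℝ T.closedInterior := by
  rw [← T.convexHull_eq_closedInterior]
  exact convex_convexHull ℝ _

theorem setLIntegral_closedInterior [FiniteDimensional ℝ E] [MeasurableSpace E] [BorelSpace E]
    {d : ℕ} (T : Affine.Simplex ℝ E d) (f : E → ENNReal) :
    ∫⁻ x in T.closedInterior, f x = ∫⁻ x in interior T.closedInterior, f x :=
  setLIntegral_congr (interior_ae_eq_of_null_frontier
    ((convex_closedInterior T).addHaar_frontier volume)).symm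

end Simplices

/-! ### Calculus of polynomial functions -/

section PolynomialFunctions

open MvPolynomial

variable {d : ℕ}

/-- The function on `ℝ^d` defined by a polynomial. -/
noncomputable def polyFun (P : MvPolynomial (Fin d) ℝ) (x : EuclideanSpace ℝ (Fin d)) : ℝ :=
  eval (fun i => x i) P

namespace polyFun

theorem mul (P Q : MvPolynomial (Fin d) ℝ) (x : EuclideanSpace ℝ (Fin d)) :
    polyFun (P * Q) x = polyFun P x * polyFun Q x := by simp [polyFun]

theorem hasFDerivAt (P : MvPolynomial (Fin d) ℝ) (x : EuclideanSpace ℝ (Fin d)) :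
    HasFDerivAt (polyFun P)
      (∑ i, polyFun (pderiv i P) x • (EuclideanSpace.proj i : EuclideanSpace ℝ (Fin d) →L[ℝ] ℝ))
      x := by
  induction P using MvPolynomial.induction_on with
  | C a =>
    have : polyFun (C a : MvPolynomial (Fin d) ℝ) = fun _ => a := by ext; simp [polyFun]
    rw [this]
    convert hasFDerivAt_const a x using 1
    simp [polyFun]
  | add P Q hP hQ =>
    have : polyFun (P + Q) = fun x => polyFun P x + polyFun Q x := by ext; simp [polyFun]
    rw [this]
    refine (hP.add hQ).congr_fderiv ?_
    rw [← Finset.sum_add_distrib]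
    exact Finset.sum_congr rfl fun i _ => by simp [polyFun, add_smul]
  | mul_X P j hP =>
    have : polyFun (P * X j) = fun x => polyFun P x * x j := by ext; simp [polyFun]
    rw [this]
    have hj : HasFDerivAt (fun x : EuclideanSpace ℝ (Fin d) => x j)
        (EuclideanSpace.proj j : EuclideanSpace ℝ (Fin d) →L[ℝ] ℝ) x :=
      (EuclideanSpace.proj j : EuclideanSpace ℝ (Fin d) →L[ℝ] ℝ).hasFDerivAt
    refine (hP.mul hj).congr_fderiv ?_
    have hi (i : Fin d) : polyFun (pderiv i (P * X j)) x =
        x j * polyFun (pderiv i P) x + if i = j then polyFun P x else 0 := by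
      rcases eq_or_ne i j with rfl | h
      · simp [polyFun, add_comm]
      · simp [polyFun, pderiv_X_of_ne h.symm, h]
    simp only [hi, add_smul, Finset.sum_add_distrib, ite_smul, zero_smul, Finset.sum_ite_eq',
      Finset.mem_univ, if_true, Finset.smul_sum, smul_smul]
    rw [add_comm]

theorem contDiff (P : MvPolynomial (Fin d) ℝ) {n : WithTop ℕ∞} : ContDiff ℝ n (polyFun P) := by
  induction P using MvPolynomial.induction_on with
  | C a =>
    have : polyFun (C a : MvPolynomial (Fin d) ℝ) = fun _ => a := by ext; simp [polyFun]
    rw [this]; exact contDiff_const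
  | add P Q hP hQ =>
    have : polyFun (P + Q) = fun x => polyFun P x + polyFun Q x := by ext; simp [polyFun]
    rw [this]; exact hP.add hQ
  | mul_X P j hP =>
    have : polyFun (P * X j) = fun x => polyFun P x * x j := by ext; simp [polyFun]
    rw [this]
    exact hP.mul (EuclideanSpace.proj j : EuclideanSpace ℝ (Fin d) →L[ℝ] ℝ).contDiff

theorem continuous (P : MvPolynomial (Fin d) ℝ) : Continuous (polyFun P) :=
  (contDiff P (n := 0)).continuous

theorem fderiv_single (P : MvPolynomial (Fin d) ℝ) (x : EuclideanSpace ℝ (Fin d)) (i : Fin d) :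
    fderiv ℝ (polyFun P) x (EuclideanSpace.single i 1) = polyFun (pderiv i P) x := by
  simp [(hasFDerivAt P x).fderiv]

theorem gradient_apply (P : MvPolynomial (Fin d) ℝ) (x : EuclideanSpace ℝ (Fin d)) (i : Fin d) :
    gradient (polyFun P) x i = polyFun (pderiv i P) x := by
  have h : inner ℝ (gradient (polyFun P) x) (EuclideanSpace.single i 1) = _ := inner_gradient_left
  rw [fderiv_single, EuclideanSpace.inner_single_right] at h
  simpa using h

theorem laplacian (P : MvPolynomial (Fin d) ℝ) (x : EuclideanSpace ℝ (Fin d)) :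
    Laplacian.laplacian (polyFun P) x = ∑ i, polyFun (pderiv i (pderiv i P)) x := by
  rw [InnerProductSpace.laplacian_eq_iteratedFDeriv_orthonormalBasis _
    (EuclideanSpace.basisFun (Fin d) ℝ)]
  refine Finset.sum_congr rfl fun i _ => ?_
  have hd : DifferentiableAt ℝ (fderiv ℝ (polyFun P)) x :=
    ((contDiff P (n := 2)).fderiv_right (m := 1) (by norm_num)).differentiable one_ne_zero x
  have h1 : fderiv ℝ (fun y => fderiv ℝ (polyFun P) y (EuclideanSpace.single i 1)) x
      (EuclideanSpace.single i 1) = polyFun (pderiv i (pderiv i P)) x := by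
    simp only [fderiv_single]
  rw [iteratedFDeriv_two_apply, ← h1, fderiv_clm_apply hd (differentiableAt_const _)]
  simp

theorem totalDegree_pderiv_le (P : MvPolynomial (Fin d) ℝ) (i : Fin d) :
    (pderiv i P).totalDegree ≤ P.totalDegree := by
  refine Finset.sup_le fun s hs => ?_
  rw [mem_support_iff, coeff_pderiv] at hs
  have h1 := le_totalDegree (mem_support_iff.2 (left_ne_zero_of_mul hs))
  rw [Finsupp.sum_add_index' (by simp) (by simp)] at h1
  exact (Nat.le_add_right _ _).trans h1

theorem apply_line (P : MvPolynomial (Fin d) ℝ) (a x : EuclideanSpace ℝ (Fin d)) (r : ℝ) :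
    polyFun P (a + r • (x - a)) =
      (aeval (fun i => Polynomial.C (x i - a i) * Polynomial.X + Polynomial.C (a i)) P).eval r := by
  induction P using MvPolynomial.induction_on with
  | C c => simp [polyFun]
  | add P Q hP hQ => rw [map_add, Polynomial.eval_add, ← hP, ← hQ]; simp [polyFun]
  | mul_X P j hP =>
    rw [map_mul, Polynomial.eval_mul, ← hP, mul, aeval_X]
    congr 1
    simp [polyFun]
    ring

theorem exists_polynomial_line (P : MvPolynomial (Fin d) ℝ) {k : ℕ} (hP : P.totalDegree ≤ k)
    (a x : EuclideanSpace ℝ (Fin d)) :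
    ∃ f : Polynomial ℝ, f.natDegree ≤ k ∧ ∀ r : ℝ, polyFun P (a + r • (x - a)) = f.eval r := by
  refine ⟨_, ?_, apply_line P a x⟩
  exact (aeval_natDegree_le P hP _ (n := 1) fun i => Polynomial.natDegree_linear_le).trans_eq
    (mul_one k)

end polyFun

end PolynomialFunctions

/-! ### From the trace inequality to the inverse estimate -/

section MainEstimate

open Module Set MvPolynomial

theorem eLpNorm_two_sq {α F : Type*} [MeasurableSpace α] [NormedAddCommGroup F] (μ : Measure α)
    (f : α → F) : eLpNorm f 2 μ ^ 2 = ∫⁻ x, ENNReal.ofReal (‖f x‖ ^ 2) ∂μ := by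
  have h := eLpNorm_nnreal_pow_eq_lintegral (μ := μ) (f := f) (p := 2) two_ne_zero
  simp only [NNReal.coe_ofNat, ENNReal.coe_ofNat, ENNReal.rpow_ofNat] at h
  rw [h]
  refine lintegral_congr fun x => ?_
  rw [ENNReal.ofReal_pow (norm_nonneg _), ofReal_norm]

variable {m : ℕ}

/-- The surface integral over one face is controlled by the integral over its simplex. -/
theorem setLIntegral_face_le (hd : finrank ℝ (EuclideanSpace ℝ (Fin (m + 1))) = m + 1)
    {p n a : EuclideanSpace ℝ (Fin (m + 1))} (hn : ‖n‖ = 1)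
    {F : Set (EuclideanSpace ℝ (Fin (m + 1)))} (hF : IsCompact F)
    (hFn : ∀ x ∈ F, inner ℝ n (x - p) = 0) (ha : inner ℝ n (a - p) ≠ 0) {h Cs : ℝ} (hh : 0 < h)
    (hreg : h ≤ Cs * (((m + 1 : ℕ) : ℝ) * volume.real (coneOver a F) /
      (μHE[m] : Measure (EuclideanSpace ℝ (Fin (m + 1)))).real F))
    {k : ℕ} {P : MvPolynomial (Fin (m + 1)) ℝ} (hP : P.totalDegree ≤ k) :
    ∫⁻ x in F, ENNReal.ofReal (polyFun P x ^ 2) ∂μHE[m] ≤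
      ENNReal.ofReal (Cs * (((k : ℝ) + 1) * ((k : ℝ) + (m + 1 : ℕ)) / h)) *
        ∫⁻ x in coneOver a F, ENNReal.ofReal (polyFun P x ^ 2) := by
  have htr := trace_inverse_inequality hd hn hF hFn ha (polyFun.continuous P) (k := k)
    (polyFun.exists_polynomial_line P hP a)
  set H : ℝ := |inner ℝ n (a - p)| with hH
  have hHpos : 0 < H := abs_pos.2 ha
  have hhH : h ≤ Cs * H := by
    rw [Nat.cast_add_one, volume_coneOver hd hn hF hFn ha] at hreg
    -- If `|F|` were zero, the quotient would be zero by convention, contradicting `0 < h`.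
    rcases eq_or_ne ((μHE[m] : Measure (EuclideanSpace ℝ (Fin (m + 1)))).real F) 0 with h0 | h0
    · rw [h0, div_zero, mul_zero] at hreg
      linarith
    · rwa [mul_div_cancel_right₀ _ h0] at hreg
  set c : ℝ := ((k : ℝ) + 1) * ((k : ℝ) + (m + 1 : ℕ)) with hc
  have hc0 : 0 ≤ c := by positivity
  calc ∫⁻ x in F, ENNReal.ofReal (polyFun P x ^ 2) ∂μHE[m]
      = ENNReal.ofReal H⁻¹ *
          (ENNReal.ofReal H * ∫⁻ x in F, ENNReal.ofReal (polyFun P x ^ 2) ∂μHE[m]) := by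
        rw [← mul_assoc, ← ENNReal.ofReal_mul (by positivity), inv_mul_cancel₀ hHpos.ne',
          ENNReal.ofReal_one, one_mul]
    _ ≤ ENNReal.ofReal H⁻¹ * (ENNReal.ofReal c *
          ∫⁻ x in coneOver a F, ENNReal.ofReal (polyFun P x ^ 2)) := by gcongr
    _ ≤ _ := by
        rw [← mul_assoc, ← ENNReal.ofReal_mul (by positivity)]
        gcongr ENNReal.ofReal ?_ * _
        rw [inv_mul_eq_div, mul_div_assoc', div_le_div_iff₀ hHpos hh]
        calc c * h ≤ c * (Cs * H) := by gcongr
          _ = Cs * c * H := by ring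

/-- Young's inequality with `c` kept beside `u`, so that summing over the components `c = nⱼ` of a
unit normal leaves no dimensional factor. -/
theorem ofReal_abs_mul_setLIntegral_le {α : Type*} [MeasurableSpace α] (μ : Measure α)
    {u w : α → ℝ} (hu : Measurable u) {M : ℝ} (hM : 0 < M) (c : ℝ) :
    ENNReal.ofReal |c| * ∫⁻ x, ‖u x * w x‖ₑ ∂μ ≤
      ENNReal.ofReal (M / 2 * c ^ 2) * ∫⁻ x, ENNReal.ofReal (u x ^ 2) ∂μ +
        ENNReal.ofReal ((2 * M)⁻¹) * ∫⁻ x, ENNReal.ofReal (w x ^ 2) ∂μ := by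
  rw [← lintegral_const_mul' _ _ ENNReal.ofReal_ne_top,
    ← lintegral_const_mul' _ _ ENNReal.ofReal_ne_top,
    ← lintegral_const_mul' _ _ ENNReal.ofReal_ne_top,
    ← lintegral_add_left (by fun_prop)]
  refine lintegral_mono fun x => ?_
  rw [← ofReal_norm, ← ENNReal.ofReal_mul (abs_nonneg _), ← ENNReal.ofReal_mul (by positivity),
    ← ENNReal.ofReal_mul (by positivity), ← ENNReal.ofReal_add (by positivity) (by positivity)]
  apply ENNReal.ofReal_le_ofReal
  rw [Real.norm_eq_abs, abs_mul, ← sq_abs c, ← sq_abs (u x), ← sq_abs (w x)]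
  have h := sq_nonneg (M * (|c| * |u x|) - |w x|)
  have e : M / 2 * |c| ^ 2 * |u x| ^ 2 + (2 * M)⁻¹ * |w x| ^ 2 - |c| * (|u x| * |w x|) =
      (2 * M)⁻¹ * (M * (|c| * |u x|) - |w x|) ^ 2 := by
    field_simp
    ring
  have : 0 ≤ (2 * M)⁻¹ * (M * (|c| * |u x|) - |w x|) ^ 2 := by positivity
  linarith

theorem integrableOn_polyFun {κ : Set (EuclideanSpace ℝ (Fin m))} (hκ : Bornology.IsBounded κ)
    (P : MvPolynomial (Fin m) ℝ) : IntegrableOn (polyFun P) κ := by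
  obtain ⟨R, hR⟩ := hκ.subset_closedBall 0
  exact ((polyFun.continuous P).continuousOn.integrableOn_compact
    (isCompact_closedBall 0 R)).mono_set hR

theorem integrableOn_polyFun_sq {κ : Set (EuclideanSpace ℝ (Fin m))} (hκ : Bornology.IsBounded κ)
    (P : MvPolynomial (Fin m) ℝ) : IntegrableOn (fun x => polyFun P x ^ 2) κ := by
  have h : polyFun (P * P) = fun x => polyFun P x ^ 2 := by ext; rw [polyFun.mul, sq]
  exact h ▸ integrableOn_polyFun hκ (P * P)

theorem setLIntegral_polyFun_sq_lt_top {κ : Set (EuclideanSpace ℝ (Fin m))}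
    (hκ : Bornology.IsBounded κ) (P : MvPolynomial (Fin m) ℝ) :
    ∫⁻ x in κ, ENNReal.ofReal (polyFun P x ^ 2) < ⊤ := by
  refine (lintegral_mono fun x => ?_).trans_lt (integrableOn_polyFun_sq hκ P).hasFiniteIntegral
  rw [← ofReal_norm]
  exact ENNReal.ofReal_le_ofReal (le_abs_self _)

/-- The inverse estimate for a polynomial that is harmonic on a bounded open set whose boundary is
covered by bases of non-overlapping cones contained in the set. -/
theorem harmonic_inverse_estimate {ι : Type*} [Fintype ι]
    {κ : Set (EuclideanSpace ℝ (Fin (m + 1)))} (hκ : IsOpen κ) (hκb : Bornology.IsBounded κ)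
    {F : ι → Set (EuclideanSpace ℝ (Fin (m + 1)))} {p n : ι → EuclideanSpace ℝ (Fin (m + 1))}
    (hn : ∀ i, ‖n i‖ = 1) (hF : ∀ i, IsCompact (F i))
    (hFn : ∀ i, ∀ x ∈ F i, inner ℝ (n i) (x - p i) = 0) (hfr : frontier κ ⊆ ⋃ i, F i)
    {P : MvPolynomial (Fin (m + 1)) ℝ} {k : ℕ} (hP : P.totalDegree ≤ k) {M : ℝ} (hM : 0 < M)
    (htrace : ∀ Q : MvPolynomial (Fin (m + 1)) ℝ, Q.totalDegree ≤ k →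
      ∑ i, ∫⁻ x in F i, ENNReal.ofReal (polyFun Q x ^ 2) ∂μHE[m] ≤
        ENNReal.ofReal M * ∫⁻ x in κ, ENNReal.ofReal (polyFun Q x ^ 2))
    (hharm : ∀ x ∈ κ, ∑ j, polyFun (pderiv j (pderiv j P)) x = 0) :
    ∑ j, ∫⁻ x in κ, ENNReal.ofReal (polyFun (pderiv j P) x ^ 2) ≤
      ENNReal.ofReal (M ^ 2) * ∫⁻ x in κ, ENNReal.ofReal (polyFun P x ^ 2) := by
  have hd : finrank ℝ (EuclideanSpace ℝ (Fin (m + 1))) = m + 1 := by simp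
  set Y := ∫⁻ x in κ, ENNReal.ofReal (polyFun P x ^ 2) with hY
  set X := ∑ j, ∫⁻ x in κ, ENNReal.ofReal (polyFun (pderiv j P) x ^ 2) with hX
  have hYtop : Y ≠ ⊤ := (setLIntegral_polyFun_sq_lt_top hκb P).ne
  have hXtop : X ≠ ⊤ := ENNReal.sum_ne_top.2 fun j _ => (setLIntegral_polyFun_sq_lt_top hκb _).ne
  -- Harmonicity enters here: the divergence of `P ∇P` is `|∇P|² + P ΔP`.
  have hXint : X = ENNReal.ofReal
      (∑ j, ∫ x in κ, fderiv ℝ (polyFun (P * pderiv j P)) x (EuclideanSpace.single j 1)) := by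
    have h1 : ∑ j, ∫ x in κ, fderiv ℝ (polyFun (P * pderiv j P)) x (EuclideanSpace.single j 1) =
        ∑ j, ∫ x in κ, polyFun (pderiv j P) x ^ 2 := by
      simp only [polyFun.fderiv_single]
      rw [← integral_finsetSum _ fun j _ => integrableOn_polyFun hκb _,
        ← integral_finsetSum _ fun j _ => integrableOn_polyFun_sq hκb _]
      refine setIntegral_congr_fun hκ.measurableSet fun x hx => ?_
      have h2 (j : Fin (m + 1)) : polyFun (pderiv j (P * pderiv j P)) x =
          polyFun (pderiv j P) x ^ 2 + polyFun P x * polyFun (pderiv j (pderiv j P)) x := by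
        simp [polyFun, sq, add_comm]
      simp only [h2]
      rw [Finset.sum_add_distrib, ← Finset.mul_sum, hharm x hx, mul_zero, add_zero]
    rw [h1, ENNReal.ofReal_sum_of_nonneg fun j _ => integral_nonneg fun x => sq_nonneg _, hX]
    refine Finset.sum_congr rfl fun j _ => ?_
    rw [ofReal_integral_eq_lintegral_ofReal]
    · exact integrableOn_polyFun_sq hκb _
    · exact Filter.Eventually.of_forall fun x => sq_nonneg _
  have hbound : X ≤ ENNReal.ofReal (M / 2) * (ENNReal.ofReal M * Y) +
      ENNReal.ofReal ((2 * M)⁻¹) * (ENNReal.ofReal M * X) := by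
    calc X ≤ ∑ j, ‖∫ x in κ, fderiv ℝ (polyFun (P * pderiv j P)) x
              (EuclideanSpace.single j 1)‖ₑ := by
          rw [hXint]
          refine (Real.ofReal_le_enorm _).trans (enorm_sum_le _ _)
      _ ≤ ∑ j, ∑ i, (ENNReal.ofReal (M / 2 * n i j ^ 2) *
              ∫⁻ x in F i, ENNReal.ofReal (polyFun P x ^ 2) ∂μHE[m] +
            ENNReal.ofReal ((2 * M)⁻¹) *
              ∫⁻ x in F i, ENNReal.ofReal (polyFun (pderiv j P) x ^ 2) ∂μHE[m]) := by
          refine Finset.sum_le_sum fun j _ => ?_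
          refine (enorm_setIntegral_fderiv_le hd hκ hκb hn hF hFn hfr
            (polyFun.contDiff (P * pderiv j P)) (EuclideanSpace.single j 1)).trans ?_
          refine Finset.sum_le_sum fun i _ => ?_
          have hnj : inner ℝ (n i) (EuclideanSpace.single j 1) = n i j := by
            simp [EuclideanSpace.inner_single_right]
          simp only [polyFun.mul, hnj]
          exact ofReal_abs_mul_setLIntegral_le _ (polyFun.continuous P).measurable hM _
      _ = ENNReal.ofReal (M / 2) * ∑ i, ∫⁻ x in F i, ENNReal.ofReal (polyFun P x ^ 2) ∂μHE[m] +
            ENNReal.ofReal ((2 * M)⁻¹) *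
              ∑ j, ∑ i, ∫⁻ x in F i, ENNReal.ofReal (polyFun (pderiv j P) x ^ 2) ∂μHE[m] := by
          simp only [Finset.sum_add_distrib, Finset.mul_sum]
          congr 1
          rw [Finset.sum_comm]
          refine Finset.sum_congr rfl fun i _ => ?_
          rw [← Finset.sum_mul, ← ENNReal.ofReal_sum_of_nonneg fun j _ => by positivity,
            ← Finset.mul_sum, ← EuclideanSpace.real_norm_sq_eq, hn i, one_pow, mul_one]
      _ ≤ _ := by
          gcongr
          · exact htrace P hP
          · rw [hX, Finset.mul_sum]
            exact Finset.sum_le_sum fun j _ =>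
              htrace _ ((polyFun.totalDegree_pderiv_le P j).trans hP)
  -- Absorbing `X / 2` into the left side requires `X` to be finite, so the rest is done in real
  -- numbers.
  rw [← ENNReal.ofReal_toReal hXtop, ← ENNReal.ofReal_toReal hYtop] at hbound ⊢
  set x := X.toReal
  set y := Y.toReal
  have hx0 : 0 ≤ x := ENNReal.toReal_nonneg
  have hy0 : 0 ≤ y := ENNReal.toReal_nonneg
  rw [← ENNReal.ofReal_mul hM.le, ← ENNReal.ofReal_mul hM.le, ← ENNReal.ofReal_mul (by positivity),
    ← ENNReal.ofReal_mul (by positivity), ← ENNReal.ofReal_add (by positivity) (by positivity),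
    ENNReal.ofReal_le_ofReal_iff (by positivity)] at hbound
  rw [← ENNReal.ofReal_mul (by positivity)]
  apply ENNReal.ofReal_le_ofReal
  have : (2 * M)⁻¹ * (M * x) = x / 2 := by field_simp
  rw [this] at hbound
  nlinarith

end MainEstimate

/-! ### Application to polytopic elements -/

namespace PolytopicElement

open Module Set MvPolynomial

theorem h_pos {d : ℕ} (hd : 0 < d) (κ : PolytopicElement d) : 0 < κ.h := by
  have : Nontrivial (EuclideanSpace ℝ (Fin d)) := by
    have : Nonempty (Fin d) := ⟨⟨0, hd⟩⟩
    infer_instance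
  obtain ⟨x, hx⟩ := κ.nonempty
  have hnhds : κ.carrier ∈ nhds x := κ.isOpen.mem_nhds hx
  exact Metric.diam_pos ((infinite_of_mem_nhds x hnhds).nontrivial) κ.isBounded

theorem gradient_estimate {m : ℕ} (κ : PolytopicElement (m + 1)) (Cs : ℝ) (hCs : 0 < Cs)
    (hκ : κ.ArbitraryFaces Cs) (k : ℕ) (v : EuclideanSpace ℝ (Fin (m + 1)) → ℝ)
    (hv : v ∈ κ.harmonicPolynomialSpace k) :
    eLpNorm (gradient v) 2 (volume.restrict κ.carrier) ^ 2 ≤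
      ENNReal.ofReal ((Cs * (((k : ℝ) + 1) * ((k : ℝ) + ((m + 1 : ℕ) : ℝ)) / κ.h)) ^ 2) *
        eLpNorm v 2 (volume.restrict κ.carrier) ^ 2 := by
  obtain ⟨⟨P, hP, hvP⟩, hΔ⟩ := hv
  obtain ⟨T, hT, hdisj, hreg⟩ := hκ
  have hh := κ.h_pos (Nat.succ_pos m)
  have hd : finrank ℝ (EuclideanSpace ℝ (Fin (m + 1))) = m + 1 := by simp
  -- `v` is a polynomial only on the element; openness lets derivatives be compared there.
  have hev {x : EuclideanSpace ℝ (Fin (m + 1))} (hx : x ∈ κ.carrier) : v =ᶠ[nhds x] polyFun P :=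
    Filter.eventuallyEq_of_mem (κ.isOpen.mem_nhds hx) hvP
  have hgrad : eLpNorm (gradient v) 2 (volume.restrict κ.carrier) ^ 2 =
      ∑ j, ∫⁻ x in κ.carrier, ENNReal.ofReal (polyFun (pderiv j P) x ^ 2) := by
    have hmeas (j : Fin (m + 1)) : Measurable fun x => ENNReal.ofReal (polyFun (pderiv j P) x ^ 2) :=
      ((polyFun.continuous _).measurable.pow_const 2).ennreal_ofReal
    rw [eLpNorm_two_sq, ← lintegral_finsetSum _ fun j _ => hmeas j]
    refine setLIntegral_congr_fun κ.isOpen.measurableSet fun x hx => ?_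
    rw [(hev hx).gradient_eq, EuclideanSpace.real_norm_sq_eq,
      ENNReal.ofReal_sum_of_nonneg fun j _ => sq_nonneg _]
    simp only [polyFun.gradient_apply]
  have hval : eLpNorm v 2 (volume.restrict κ.carrier) ^ 2 =
      ∫⁻ x in κ.carrier, ENNReal.ofReal (polyFun P x ^ 2) := by
    rw [eLpNorm_two_sq]
    refine setLIntegral_congr_fun κ.isOpen.measurableSet fun x hx => ?_
    rw [(hev hx).eq_of_nhds, Real.norm_eq_abs, sq_abs]
  choose hTκ i hTi using hT
  choose p n hn hFn ha using fun F : κ.faces => exists_unit_normal (T F) F.1 (i F) (hTi F)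
  have hcone (F : κ.faces) := closedInterior_eq_coneOver (T F) F.1 (i F) (hTi F)
  have := κ.finite_faces.fintype
  rw [hgrad, hval]
  refine harmonic_inverse_estimate (ι := κ.faces) (F := fun F => F.1.closedInterior) κ.isOpen
    κ.isBounded hn (fun F => F.1.isCompact_closedInterior) hFn ?_ hP (by positivity) ?_ ?_
  · rw [κ.frontier_eq, biUnion_eq_iUnion]
  · intro Q hQ
    calc ∑ F : κ.faces, ∫⁻ x in F.1.closedInterior, ENNReal.ofReal (polyFun Q x ^ 2) ∂μHE[m]
        ≤ ∑ F : κ.faces, ENNReal.ofReal (Cs * (((k : ℝ) + 1) * ((k : ℝ) + (m + 1 : ℕ)) / κ.h)) *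
            ∫⁻ x in interior (T F).closedInterior, ENNReal.ofReal (polyFun Q x ^ 2) := by
          refine Finset.sum_le_sum fun F _ => ?_
          rw [← setLIntegral_closedInterior, hcone F]
          refine setLIntegral_face_le hd (hn F) F.1.isCompact_closedInterior (hFn F) (ha F) hh
            ?_ hQ
          rw [← hcone F]
          exact hreg F
      -- Closed simplices may share boundary points; their interiors are disjoint and carry the full
      -- integrals.
      _ = ENNReal.ofReal (Cs * (((k : ℝ) + 1) * ((k : ℝ) + (m + 1 : ℕ)) / κ.h)) *
            ∫⁻ x in ⋃ F, interior (T F).closedInterior, ENNReal.ofReal (polyFun Q x ^ 2) := by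
          rw [← Finset.mul_sum, lintegral_iUnion (fun F => isOpen_interior.measurableSet)
            (fun F G hFG => (hdisj hFG).mono (interior_closedInterior_subset hd _)
              (interior_closedInterior_subset hd _)), tsum_fintype]
      _ ≤ _ := by
          gcongr
          exact iUnion_subset fun F => (interior_closedInterior_subset hd _).trans (hTκ F)
  · intro x hx
    rw [← polyFun.laplacian, ← hΔ x hx]
    exact (InnerProductSpace.laplacian_congr_nhds (hev hx)).eq_of_nhds.symm

end PolytopicElement

theorem mainTheorem3 (d : ℕ) (hd : d = 2 ∨ d = 3) (κ : PolytopicElement d)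
    (Cs : ℝ) (hCs : 0 < Cs) (hκ : κ.ArbitraryFaces Cs) (p : ℕ)
    (v : EuclideanSpace ℝ (Fin d) → ℝ) (hv : v ∈ κ.harmonicPolynomialSpace p) :
    eLpNorm (gradient v) 2 (volume.restrict κ.carrier) ^ 2 ≤
      ENNReal.ofReal ((Cs * (((p : ℝ) + 1) * ((p : ℝ) + (d : ℝ)) / κ.h)) ^ 2) *
        eLpNorm v 2 (volume.restrict κ.carrier) ^ 2 := by
  obtain ⟨m, rfl⟩ : ∃ m, d = m + 1 := Nat.exists_eq_add_one.2 (by omega)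
  exact κ.gradient_estimate Cs hCs hκ p v hv
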